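/- A bipartite graph $G=(X,Y,E)$ is finite and comes with a fixed bipartition; its bipartite adjacency matrix $\mathrm{Adj}_G\in\{\pm1\}^{X\times Y}$ has entry $1$ at $(x,y)$ if and only if $xy\in E$. A class of bipartite graphs is hereditary if it is closed under isomorphism and under induced subgraphs. The sign-rank of a $\pm1$ matrix $M$ is the least rank of a real matrix $R$ with $\mathrm{sign}(R)=M$ entrywise (so $R$ has no zero entries), and a class of bipartite graphs has sign-rank $d$ if $d$ is the maximum of the sign-ranks of the bipartite adjacency matrices of its members. The query set of the Equality problem is the closure of the set of all $N\times N$ identity matrices (written with entries $1$ on the diagonal and $-1$ off the diagonal) under permuting rows and columns, taking submatrices, and duplicating a row or a column. A deterministic protocol with Equality oracles for a matrix $M\in\{\pm1\}^{X\times Y}$ is a rooted binary tree in which each leaf carries a value in $\{\pm1\}$ and each inner node $v$ carries an $X\times Y$ matrix $Q_v$ from this query set; on input $(x,y)$ one starts at the root and at an inner node $v$ moves to the left child if $Q_v(x,y)=-1$ and to the right child if $Q_v(x,y)=1$, and the value at the leaf that is reached must be $M(x,y)$, for all $(x,y)$. $\mathsf{D}^{\mathrm{Eq}}(M)$ is the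 minimum depth of such a protocol, and for a class $\mathcal G$ of bipartite graphs $\mathsf{D}^{\mathrm{Eq}}(\mathcal G)$ is the function $N\mapsto\max\{\mathsf{D}^{\mathrm{Eq}}(\mathrm{Adj}_G) : G\in\mathcal G \text{ has } N \text{ vertices}\}$. A point-box incidence graph is a bipartite graph isomorphic to $(P,H,\{ph : p\in P,\ h\in H,\ p\in h\})$ for a finite set $P$ of points in $\mathbb R^2$ and a finite set $H$ of axis-aligned rectangles $[a,b]\times[c,d]$, $a<b$, $c<d$, in $\mathbb R^2$. **Corollary.** There is a hereditary class $\mathcal G$ of $K_{2,2}$-free bipartite graphs, namely the class of all $K_{2,2}$-free point-box incidence graphs, that has sign-rank $5$ and satisfies $\mathsf{D}^{\mathrm{Eq}}(\mathcal G)=\omega(1)$, that is, $\mathsf{D}^{\mathrm{Eq}}(\mathcal G)(N)\to\infty$ as $N\to\infty$. -/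

import Mathlib

/-- A finite bipartite graph `(X, Y, E)` with a fixed bipartition. -/
structure BipGraph where
  X : Type
  Y : Type
  [fintypeX : Fintype X]
  [fintypeY : Fintype Y]
  Adj : X → Y → Prop

namespace BipGraph

attribute [instance] BipGraph.fintypeX BipGraph.fintypeY

/-- The number of vertices. -/
def numVertices (G : BipGraph) : ℕ := Fintype.card G.X + Fintype.card G.Y

/-- Isomorphism of bipartite graphs with fixed bipartitions. -/
def Isomorphic (G H : BipGraph) : Prop :=
  ∃ (e : G.X ≃ H.X) (f : G.Y ≃ H.Y), ∀ x y, G.Adj x y ↔ H.Adj (e x) (f y)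

/-- The subgraph induced by `S ∪ T` with `S ⊆ X` and `T ⊆ Y`. -/
def induce (G : BipGraph) (S : Finset G.X) (T : Finset G.Y) : BipGraph where
  X := {x // x ∈ S}
  Y := {y // y ∈ T}
  Adj x y := G.Adj x.1 y.1

/-- `G` has no `K_{2,2}` subgraph. -/
def K22Free (G : BipGraph) : Prop :=
  ∀ x₁ x₂ : G.X, ∀ y₁ y₂ : G.Y, x₁ ≠ x₂ → y₁ ≠ y₂ →
    ¬ (G.Adj x₁ y₁ ∧ G.Adj x₁ y₂ ∧ G.Adj x₂ y₁ ∧ G.Adj x₂ y₂)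

open Classical in
/-- The bipartite adjacency matrix, with entries in `{±1}` (the units of `ℤ`). -/
noncomputable def adjMatrix (G : BipGraph) : Matrix G.X G.Y ℤˣ :=
  Matrix.of fun x y => if G.Adj x y then 1 else -1

/-- A hereditary class: closed under isomorphism and under induced subgraphs. -/
structure IsHereditary (𝒢 : Set BipGraph) : Prop where
  iso_mem : ∀ G ∈ 𝒢, ∀ H : BipGraph, G.Isomorphic H → H ∈ 𝒢
  induce_mem : ∀ G ∈ 𝒢, ∀ (S : Finset G.X) (T : Finset G.Y), G.induce S T ∈ 𝒢

end BipGraph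

/-- The sign-rank of a `±1` matrix `M`: the least rank of a real matrix `R` with `M = sign(R)`
entrywise (in particular all entries of `R` are non-zero). -/
noncomputable def signRank {X Y : Type} [Fintype Y] (M : Matrix X Y ℤˣ) : ℕ :=
  sInf {d | ∃ R : Matrix X Y ℝ, R.rank = d ∧ ∀ x y, Real.sign (R x y) = ((M x y : ℤ) : ℝ)}

/-- A class of bipartite graphs has sign-rank `d` if `d` is the maximum of the sign-ranks of the
bipartite adjacency matrices of its members. -/
def HasSignRank (𝒢 : Set BipGraph) (d : ℕ) : Prop :=
  IsGreatest {r | ∃ G ∈ 𝒢, r = signRank G.adjMatrix} d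

/-! ### Deterministic communication with oracles -/

/-- A set of `±1` matrices, of arbitrary shapes. -/
abbrev MatrixSet := ∀ X Y : Type, Matrix X Y ℤˣ → Prop

/-- The query set of `P`: the closure of `P` under row and column permutations (with relabelling
of the index sets), submatrices, and duplication of a row or of a column. -/
inductive QuerySet (P : MatrixSet) : MatrixSet
  | base {X Y : Type} {Q : Matrix X Y ℤˣ} : P X Y Q → QuerySet P X Y Q
  | permute {X Y X' Y' : Type} {Q : Matrix X Y ℤˣ} (e : X' ≃ X) (f : Y' ≃ Y) :
      QuerySet P X Y Q → QuerySet P X' Y' (Q.submatrix e f)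
  | sub {X Y : Type} {Q : Matrix X Y ℤˣ} (S : Set X) (T : Set Y) :
      QuerySet P X Y Q → QuerySet P S T (Q.submatrix Subtype.val Subtype.val)
  | dupRow {X Y : Type} {Q : Matrix X Y ℤˣ} (x : X) :
      QuerySet P X Y Q → QuerySet P (Option X) Y (Q.submatrix (fun o => o.getD x) id)
  | dupCol {X Y : Type} {Q : Matrix X Y ℤˣ} (y : Y) :
      QuerySet P X Y Q → QuerySet P X (Option Y) (Q.submatrix id (fun o => o.getD y))

/-- The Equality problem: all `N × N` identity matrices, written with entries `1` on the diagonal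
and `-1` off it. -/
inductive EqualityProblem : MatrixSet
  | mk (N : ℕ) : EqualityProblem (Fin N) (Fin N) (Matrix.of fun i j => if i = j then 1 else -1)

/-- A deterministic protocol with `B` oracles on inputs from `X × Y`: a rooted binary tree whose
leaves carry an output in `{±1}` and whose inner nodes carry a matrix from the query set of `B`. -/
inductive OracleProtocol (B : MatrixSet) (X Y : Type) : Type
  | leaf (b : ℤˣ) : OracleProtocol B X Y
  | node (Q : Matrix X Y ℤˣ) (hQ : QuerySet B X Y Q) (left right : OracleProtocol B X Y) :
      OracleProtocol B X Y

namespace OracleProtocol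

variable {B : MatrixSet} {X Y : Type}

/-- The output on the inputs `x, y`: at an inner node go left if the answer is `-1` and right if
it is `1`. -/
def output : OracleProtocol B X Y → X → Y → ℤˣ
  | leaf b, _, _ => b
  | node Q _ left right, x, y => if Q x y = -1 then left.output x y else right.output x y

/-- The depth of the tree. -/
def depth : OracleProtocol B X Y → ℕ
  | leaf _ => 0
  | node _ _ left right => max left.depth right.depth + 1

/-- The protocol computes the matrix `P`. -/
def Computes (T : OracleProtocol B X Y) (P : Matrix X Y ℤˣ) : Prop :=
  ∀ x y, T.output x y = P x y

end OracleProtocol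

/-- `D^B(P)`: the minimum cost of a protocol that computes `P` with `B` oracles. -/
noncomputable def oracleCost (B : MatrixSet) {X Y : Type} (P : Matrix X Y ℤˣ) : ℕ :=
  sInf {c | ∃ T : OracleProtocol B X Y, T.Computes P ∧ T.depth = c}

/-- `D^Eq(𝒢)`: the function that maps `N` to the maximum of `D^Eq` of the bipartite adjacency
matrices of the graphs in `𝒢` with `N` vertices. -/
noncomputable def equalityCost (𝒢 : Set BipGraph) (N : ℕ) : ℕ :=
  sSup {c | ∃ G ∈ 𝒢, G.numVertices = N ∧ c = oracleCost EqualityProblem G.adjMatrix}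

/-! ### Point-box incidence graphs -/

/-- A (closed, non-degenerate) axis-aligned rectangle in the plane. -/
def IsBox (h : Set (ℝ × ℝ)) : Prop :=
  ∃ a b c d : ℝ, a < b ∧ c < d ∧ h = Set.Icc a b ×ˢ Set.Icc c d

/-- The incidence graph of a finite set `P` of points and a finite set `H` of subsets of the
plane. -/
def incidenceGraph (P : Finset (ℝ × ℝ)) (H : Finset (Set (ℝ × ℝ))) : BipGraph where
  X := {p // p ∈ P}
  Y := {h // h ∈ H}
  Adj p h := p.1 ∈ h.1

/-- The class of graphs isomorphic to the incidence graph of a finite set of points and a finite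
set of axis-aligned rectangles in the plane. -/
def pointBoxGraphs : Set BipGraph :=
  {G | ∃ (P : Finset (ℝ × ℝ)) (H : Finset (Set (ℝ × ℝ))),
    (∀ h ∈ H, IsBox h) ∧ G.Isomorphic (incidenceGraph P H)}

/-- The class of `K_{2,2}`-free point-box incidence graphs. -/
def k22FreePointBoxGraphs : Set BipGraph :=
  {G | G ∈ pointBoxGraphs ∧ G.K22Free}

/-!
# Point-box incidence graphs: sign-rank and Equality oracles

The theorem combines three facts about `K_{2,2}`-free incidence graphs of points and boxes.

**Sign-rank at most five.** For large `t`, the sign of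
`5 - exp (t (x - b)) - exp (t (a - x)) - exp (t (y - d)) - exp (t (c - y))` tells whether `(x, y)`
lies in `[a, b] × [c, d]`: inside the box each exponential is at most `1`, and outside of it one of
them is huge. Each of the five summands is a product of a function of the point and a function of
the box (`eventually_sign_box`, `signRank_le_five`).

**Sign-rank at least five.** Take three points on a decreasing chain, three more on another
decreasing chain below and to the left of the first, and small boxes around the single points and
around all pairs of points other than the pairs of ends of a chain. In rank at most four, any five rows are linearly dependent.
The positive part of the dependency cannot be contained in a pair that has its own column, nor can
the negative part, so if only one pair of the five is missing, the dependency has that pair on one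
side and the other three indices on the other (`signs_of_relation`). Three such dependencies
combine to a dependency of four rows, which is impossible for the same reason
(`four_lt_rank_of_isSeparated`).

**Unbounded cost.** An Equality query compares a colour of the row with a colour of the column.
If a protocol of depth `d` computes a `K_{2,2}`-free matrix, then every `A × B` submatrix has at most
`5 ^ d * (|A| + |B|)` entries `1` (`OracleProtocol.card_output_eq_one_le`): pairs of equal colours
form disjoint rectangles, and a random set of colours shows that pairs of distinct colours contain
a rectangle with a quarter of the relevant entries. On the other hand, words of length `b` over `b`
letters and the axis-parallel combinatorial lines form a `K_{2,2}`-free graph of average degree `b`.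
It is a point-box graph: map a word to the pair of numbers that it and its reversal
represent in base `b`; the words of a line in direction `s` share the leading digits of both
coordinates, up to position `s` from either side, and so are cut out by a box
(`wordPoint_mem_Icc_iff`). Isolated points provide graphs of every large order. The maximum over the
graphs with `N` vertices exists since every matrix has a protocol that goes through its rows one by
one (`exists_oracleProtocol`).
-/

/-! ### Realizations by points and boxes -/

/-- A bipartite graph is a point-box incidence graph as soon as its vertices can be labelled
injectively by points and by boxes in such a way that adjacency is membership. -/
theorem mem_pointBoxGraphs_iff {G : BipGraph} :
    G ∈ pointBoxGraphs ↔ ∃ (p : G.X → ℝ × ℝ) (h : G.Y → Set (ℝ × ℝ)),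
      Function.Injective p ∧ Function.Injective h ∧ (∀ y, IsBox (h y)) ∧
        ∀ x y, G.Adj x y ↔ p x ∈ h y := by
  classical
  constructor
  · rintro ⟨P, H, hH, e, f, hef⟩
    exact ⟨fun x => (e x).1, fun y => (f y).1, Subtype.val_injective.comp e.injective,
      Subtype.val_injective.comp f.injective, fun y => hH _ (f y).2, hef⟩
  · rintro ⟨p, h, hp, hh, hbox, hadj⟩
    refine ⟨Finset.univ.image p, Finset.univ.image h, ?_, ?_⟩
    · intro b hb
      obtain ⟨y, -, rfl⟩ := Finset.mem_image.1 hb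
      exact hbox y
    · refine ⟨Equiv.ofBijective (fun x => ⟨p x, by simp⟩) ⟨?_, ?_⟩,
        Equiv.ofBijective (fun y => ⟨h y, by simp⟩) ⟨?_, ?_⟩, fun x y => hadj x y⟩
      · intro a b hab
        exact hp (congrArg Subtype.val hab)
      · rintro ⟨q, hq⟩
        obtain ⟨x, -, rfl⟩ := Finset.mem_image.1 hq
        exact ⟨x, rfl⟩
      · intro a b hab
        exact hh (congrArg Subtype.val hab)
      · rintro ⟨q, hq⟩
        obtain ⟨x, -, rfl⟩ := Finset.mem_image.1 hq
        exact ⟨x, rfl⟩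

theorem isHereditary_k22FreePointBoxGraphs : BipGraph.IsHereditary k22FreePointBoxGraphs where
  iso_mem := by
    rintro G ⟨hG, hK⟩ H ⟨e, f, hef⟩
    obtain ⟨p, h, hp, hh, hbox, hadj⟩ := mem_pointBoxGraphs_iff.1 hG
    refine ⟨mem_pointBoxGraphs_iff.2 ⟨p ∘ e.symm, h ∘ f.symm, hp.comp e.symm.injective,
      hh.comp f.symm.injective, fun y => hbox _, fun x y => ?_⟩, ?_⟩
    · simp [← hadj, hef]
    · intro x₁ x₂ y₁ y₂ hx hy
      have := hK (e.symm x₁) (e.symm x₂) (f.symm y₁) (f.symm y₂) (by simpa) (by simpa)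
      simpa [hef] using this
  induce_mem := by
    rintro G ⟨hG, hK⟩ S T
    obtain ⟨p, h, hp, hh, hbox, hadj⟩ := mem_pointBoxGraphs_iff.1 hG
    refine ⟨mem_pointBoxGraphs_iff.2 ⟨fun x => p x.1, fun y => h y.1,
      hp.comp Subtype.val_injective, hh.comp Subtype.val_injective, fun y => hbox _,
      fun x y => hadj _ _⟩, ?_⟩
    intro x₁ x₂ y₁ y₂ hx hy
    exact hK _ _ _ _ (fun h => hx (Subtype.ext h)) (fun h => hy (Subtype.ext h))

/-- The incidence graph of points and order intervals of `ℕ × ℕ`. -/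
abbrev gridGraph {A B : Type} [Fintype A] [Fintype B] (p : A → ℕ × ℕ) (lo hi : B → ℕ × ℕ) :
    BipGraph where
  X := A
  Y := B
  Adj a b := p a ∈ Set.Icc (lo b) (hi b)

theorem natCast_mem_Icc_add_half {a b n : ℕ} :
    (n : ℝ) ∈ Set.Icc (a : ℝ) (b + 1 / 2) ↔ n ∈ Set.Icc a b := by
  refine and_congr Nat.cast_le ⟨fun h => ?_, fun h => ?_⟩
  · have h' : (n : ℝ) < ((b + 1 : ℕ) : ℝ) := by push_cast; linarith
    exact Nat.lt_succ_iff.1 (Nat.cast_lt.1 h')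
  · have h' : (n : ℝ) ≤ b := Nat.cast_le.2 h
    linarith

/-- Order intervals of `ℕ × ℕ` become boxes once their upper ends are moved by `1 / 2`, which makes
them non-degenerate and adds no lattice point. Distinct neighbourhoods are required because the
boxes of an incidence graph form a set. -/
theorem gridGraph_mem_pointBoxGraphs {A B : Type} [Fintype A] [Fintype B] {p : A → ℕ × ℕ}
    {lo hi : B → ℕ × ℕ} (hp : Function.Injective p) (hle : ∀ b, lo b ≤ hi b)
    (hinj : ∀ b b', (∀ a, p a ∈ Set.Icc (lo b) (hi b) ↔ p a ∈ Set.Icc (lo b') (hi b')) → b = b') :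
    gridGraph p lo hi ∈ pointBoxGraphs := by
  have key : ∀ a b, p a ∈ Set.Icc (lo b) (hi b) ↔
      (((p a).1 : ℝ), ((p a).2 : ℝ)) ∈
        Set.Icc ((lo b).1 : ℝ) ((hi b).1 + 1 / 2) ×ˢ
          Set.Icc ((lo b).2 : ℝ) ((hi b).2 + 1 / 2) := by
    intro a b
    rw [Set.mem_prod, natCast_mem_Icc_add_half, natCast_mem_Icc_add_half]
    simp only [Set.mem_Icc, Prod.le_def]
    tauto
  refine mem_pointBoxGraphs_iff.2 ⟨fun a => ((p a).1, (p a).2),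
    fun b => Set.Icc ((lo b).1 : ℝ) ((hi b).1 + 1 / 2) ×ˢ
          Set.Icc ((lo b).2 : ℝ) ((hi b).2 + 1 / 2), ?_, ?_, ?_, key⟩
  · intro a a' h
    simp only [Prod.mk.injEq, Nat.cast_inj] at h
    exact hp (Prod.ext h.1 h.2)
  · intro b b' h
    refine hinj b b' fun a => ?_
    rw [key, key]
    exact Set.ext_iff.1 h _
  · intro b
    refine ⟨_, _, _, _, ?_, ?_, rfl⟩
    · have : ((lo b).1 : ℝ) ≤ (hi b).1 := Nat.cast_le.2 (hle b).1
      linarith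
    · have : ((lo b).2 : ℝ) ≤ (hi b).2 := Nat.cast_le.2 (hle b).2
      linarith

/-- Isolated points can be added far away from all boxes. -/
theorem exists_gridGraph_sum_fin {A B : Type} [Fintype A] [Fintype B] {p : A → ℕ × ℕ}
    {lo hi : B → ℕ × ℕ} (hp : Function.Injective p) (hle : ∀ b, lo b ≤ hi b)
    (hinj : ∀ b b', (∀ a, p a ∈ Set.Icc (lo b) (hi b) ↔ p a ∈ Set.Icc (lo b') (hi b')) → b = b')
    (hK : (gridGraph p lo hi).K22Free) (t : ℕ) :
    ∃ q : A ⊕ Fin t → ℕ × ℕ, (∀ a, q (.inl a) = p a) ∧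
      gridGraph q lo hi ∈ k22FreePointBoxGraphs := by
  obtain ⟨M₁, hM₁⟩ := (Set.finite_range fun a => (p a).1).bddAbove
  obtain ⟨M₂, hM₂⟩ := (Set.finite_range fun b => (hi b).1).bddAbove
  have h₁ : ∀ a, (p a).1 ≤ M₁ := fun a => hM₁ ⟨a, rfl⟩
  have h₂ : ∀ b, (hi b).1 ≤ M₂ := fun b => hM₂ ⟨b, rfl⟩
  let q : A ⊕ Fin t → ℕ × ℕ := Sum.elim p fun i => (M₁ + M₂ + 1 + i, 0)
  have hq : ∀ i b, q (.inr i) ∉ Set.Icc (lo b) (hi b) := by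
    intro i b h
    have h' : M₁ + M₂ + 1 + i ≤ (hi b).1 := h.2.1
    have := h₂ b
    omega
  refine ⟨q, fun a => rfl, gridGraph_mem_pointBoxGraphs ?_ hle ?_, ?_⟩
  · refine hp.sumElim ?_ ?_
    · intro i j h
      simp only [Prod.mk.injEq] at h
      exact Fin.ext (by omega)
    · intro a i h
      have h' := congrArg Prod.fst h
      have := h₁ a
      simp only at h'
      omega
  · exact fun b b' h => hinj b b' fun a => h (.inl a)
  · rintro (x₁ | x₁) (x₂ | x₂) y₁ y₂ hx hy ⟨k₁, k₂, k₃, k₄⟩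
    · exact hK x₁ x₂ y₁ y₂ (fun h => hx (congrArg _ h)) hy ⟨k₁, k₂, k₃, k₄⟩
    · exact hq _ _ k₃
    · exact hq _ _ k₁
    · exact hq _ _ k₁

/-! ### Sign-rank at most five -/

open Filter in
/-- For `t ≥ 0` the exponentials `exp (t (x - b))`, `exp (t (a - x))`, `exp (t (y - d))` and
`exp (t (c - y))` are at most `1` if `(x, y)` lies in `[a, b] × [c, d]`; otherwise one of them
exceeds `5` for large `t`. Each is a product of a function of the point and one of the box. -/
theorem eventually_sign_box (a b c d : ℝ) (q : ℝ × ℝ) :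
    ∀ᶠ t : ℝ in atTop,
      (q ∈ Set.Icc a b ×ˢ Set.Icc c d → 0 < 5 - (Real.exp (t * q.1) * Real.exp (-(t * b)) +
        Real.exp (-(t * q.1)) * Real.exp (t * a) + Real.exp (t * q.2) * Real.exp (-(t * d)) +
        Real.exp (-(t * q.2)) * Real.exp (t * c))) ∧
      (q ∉ Set.Icc a b ×ˢ Set.Icc c d → 5 - (Real.exp (t * q.1) * Real.exp (-(t * b)) +
        Real.exp (-(t * q.1)) * Real.exp (t * a) + Real.exp (t * q.2) * Real.exp (-(t * d)) +
        Real.exp (-(t * q.2)) * Real.exp (t * c)) < 0) := by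
  have big : ∀ u : ℝ, 0 < u → ∀ᶠ t : ℝ in atTop, 5 < Real.exp (t * u) := fun u hu =>
    (Real.tendsto_exp_atTop.comp (tendsto_id.atTop_mul_const hu)).eventually_gt_atTop 5
  have hev : ∀ u : ℝ, ∀ᶠ t : ℝ in atTop, (u ≤ 0 → Real.exp (t * u) ≤ 1) ∧
      (0 < u → 5 < Real.exp (t * u)) := by
    intro u
    rcases le_or_gt u 0 with hu | hu
    · filter_upwards [eventually_ge_atTop 0] with t ht
      exact ⟨fun _ => Real.exp_le_one_iff.2 (mul_nonpos_of_nonneg_of_nonpos ht hu),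
        fun h => absurd hu h.not_ge⟩
    · filter_upwards [big u hu] with t ht
      exact ⟨fun h => absurd hu h.not_gt, fun _ => ht⟩
  filter_upwards [hev (q.1 - b), hev (a - q.1), hev (q.2 - d), hev (c - q.2)] with t h₁ h₂ h₃ h₄
  have e₁ : Real.exp (t * q.1) * Real.exp (-(t * b)) = Real.exp (t * (q.1 - b)) := by
    rw [← Real.exp_add]; ring_nf
  have e₂ : Real.exp (-(t * q.1)) * Real.exp (t * a) = Real.exp (t * (a - q.1)) := by
    rw [← Real.exp_add]; ring_nf
  have e₃ : Real.exp (t * q.2) * Real.exp (-(t * d)) = Real.exp (t * (q.2 - d)) := by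
    rw [← Real.exp_add]; ring_nf
  have e₄ : Real.exp (-(t * q.2)) * Real.exp (t * c) = Real.exp (t * (c - q.2)) := by
    rw [← Real.exp_add]; ring_nf
  rw [e₁, e₂, e₃, e₄]
  constructor
  · rintro ⟨⟨k₁, k₂⟩, k₃, k₄⟩
    have := h₁.1 (by linarith)
    have := h₂.1 (by linarith)
    have := h₃.1 (by linarith)
    have := h₄.1 (by linarith)
    linarith
  · intro h
    have p₁ := Real.exp_pos (t * (q.1 - b))
    have p₂ := Real.exp_pos (t * (a - q.1))
    have p₃ := Real.exp_pos (t * (q.2 - d))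
    have p₄ := Real.exp_pos (t * (c - q.2))
    by_contra hcon
    refine h ⟨⟨?_, ?_⟩, ?_, ?_⟩ <;> by_contra hlt
    · have := h₂.2 (by linarith)
      linarith
    · have := h₁.2 (by linarith)
      linarith
    · have := h₄.2 (by linarith)
      linarith
    · have := h₃.2 (by linarith)
      linarith

theorem exists_rank_le_five_of_mem_pointBoxGraphs {G : BipGraph} (hG : G ∈ pointBoxGraphs) :
    ∃ R : Matrix G.X G.Y ℝ, R.rank ≤ 5 ∧
      ∀ x y, Real.sign (R x y) = ((G.adjMatrix x y : ℤ) : ℝ) := by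
  obtain ⟨p, h, -, -, hbox, hadj⟩ := mem_pointBoxGraphs_iff.1 hG
  choose a b c d _ _ hh using hbox
  obtain ⟨t, ht⟩ := (Filter.eventually_all.2 fun x => Filter.eventually_all.2 fun y =>
    eventually_sign_box (a y) (b y) (c y) (d y) (p x)).exists
  let U : Matrix G.X (Fin 5) ℝ := Matrix.of fun x => ![Real.exp (t * (p x).1),
    Real.exp (-(t * (p x).1)), Real.exp (t * (p x).2), Real.exp (-(t * (p x).2)), 5]
  let V : Matrix (Fin 5) G.Y ℝ := Matrix.of fun i y => ![-Real.exp (-(t * b y)),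
    -Real.exp (t * a y), -Real.exp (-(t * d y)), -Real.exp (t * c y), 1] i
  refine ⟨U * V, (Matrix.rank_mul_le_left U V).trans
    (U.rank_le_card_width.trans (by simp)), fun x y => ?_⟩
  have hUV : (U * V) x y = 5 - (Real.exp (t * (p x).1) * Real.exp (-(t * b y)) +
        Real.exp (-(t * (p x).1)) * Real.exp (t * a y) +
        Real.exp (t * (p x).2) * Real.exp (-(t * d y)) +
        Real.exp (-(t * (p x).2)) * Real.exp (t * c y)) := by
    simp [U, V, Matrix.mul_apply, Fin.sum_univ_five]
    ring
  have := ht x y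
  rw [← hUV, ← hh y, ← hadj] at this
  by_cases hxy : G.Adj x y
  · simp [BipGraph.adjMatrix, hxy, Real.sign_of_pos (this.1 hxy)]
  · simp [BipGraph.adjMatrix, hxy, Real.sign_of_neg (this.2 hxy)]

theorem signRank_le_five {G : BipGraph} (hG : G ∈ pointBoxGraphs) : signRank G.adjMatrix ≤ 5 := by
  obtain ⟨R, hR, hs⟩ := exists_rank_le_five_of_mem_pointBoxGraphs hG
  have h : signRank G.adjMatrix ≤ R.rank := Nat.sInf_le ⟨R, rfl, hs⟩
  exact h.trans hR

/-- The minimum in the definition of sign-rank is attained: the signs themselves give a matrix. -/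
theorem exists_rank_eq_signRank {X Y : Type} [Fintype Y] (M : Matrix X Y ℤˣ) :
    ∃ R : Matrix X Y ℝ, R.rank = signRank M ∧
      ∀ x y, Real.sign (R x y) = ((M x y : ℤ) : ℝ) := by
  refine Nat.sInf_mem (s := {d | ∃ R : Matrix X Y ℝ, R.rank = d ∧
    ∀ x y, Real.sign (R x y) = ((M x y : ℤ) : ℝ)})
    ⟨_, Matrix.of fun x y => ((M x y : ℤ) : ℝ), rfl, fun x y => ?_⟩
  rcases Int.units_eq_one_or (M x y) with h | h <;> simp [h, Real.sign_neg]

/-! ### Sign-rank at least five -/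

/-- Some column of the real matrix with rows `r` is positive exactly in the rows `k` and `l` and
negative in all others. -/
def IsSeparated {ι κ : Type} (r : ι → κ → ℝ) (k l : ι) : Prop :=
  ∃ y, ∀ m, (m = k ∨ m = l → 0 < r m y) ∧ (m ≠ k → m ≠ l → r m y < 0)

/-- A linear relation among the rows vanishes if its signs agree with those of a column. -/
theorem IsSeparated.eq_zero_of_nonneg {ι κ : Type} [Fintype ι] {r : ι → κ → ℝ} {k l : ι}
    (h : IsSeparated r k l) {c : ι → ℝ} (hc : ∑ m, c m • r m = 0) (hk : 0 ≤ c k) (hl : 0 ≤ c l)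
    (hneg : ∀ m, m ≠ k → m ≠ l → c m ≤ 0) : c = 0 := by
  obtain ⟨y, hy⟩ := h
  have hsum : ∑ m, c m * r m y = 0 := by simpa using congrFun hc y
  have hterm : ∀ m, 0 ≤ c m * r m y ∧ r m y ≠ 0 := by
    intro m
    by_cases hm : m = k ∨ m = l
    · have hpos := (hy m).1 hm
      have : 0 ≤ c m := by rcases hm with rfl | rfl <;> assumption
      exact ⟨by positivity, hpos.ne'⟩
    · push Not at hm
      have hr := (hy m).2 hm.1 hm.2
      exact ⟨mul_nonneg_of_nonpos_of_nonpos (hneg m hm.1 hm.2) hr.le, hr.ne⟩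
  funext m
  have := (Finset.sum_eq_zero_iff_of_nonneg fun m _ => (hterm m).1).1 hsum m (Finset.mem_univ m)
  exact (mul_eq_zero.1 this).resolve_right (hterm m).2

theorem IsSeparated.eq_zero {ι κ : Type} [Fintype ι] {r : ι → κ → ℝ} {k l : ι}
    (h : IsSeparated r k l) (hself : ∀ m, IsSeparated r m m) {c : ι → ℝ}
    (hc : ∑ m, c m • r m = 0) {o : ι} (ho : c o = 0) (hneg : ∀ m, m ≠ k → m ≠ l → c m ≤ 0) :
    c = 0 := by
  rcases le_total 0 (c k) with hk | hk <;> rcases le_total 0 (c l) with hl | hl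
  · exact h.eq_zero_of_nonneg hc hk hl hneg
  · refine (hself k).eq_zero_of_nonneg hc hk hk fun m hm _ => ?_
    by_cases hml : m = l
    · exact hml ▸ hl
    · exact hneg m hm hml
  · refine (hself l).eq_zero_of_nonneg hc hl hl fun m hm _ => ?_
    by_cases hmk : m = k
    · exact hmk ▸ hk
    · exact hneg m hmk hm
  · refine (hself o).eq_zero_of_nonneg hc ho.ge ho.ge fun m _ _ => ?_
    by_cases hmk : m = k
    · exact hmk ▸ hk
    by_cases hml : m = l
    · exact hml ▸ hl
    exact hneg m hmk hml

/-- Radon partition of five vectors all of whose pairs but `{p, q}` are separated: a relation among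
them puts `p` and `q` on one side and the other three on the other. -/
theorem signs_of_relation {ι κ : Type} [Fintype ι] {r : ι → κ → ℝ}
    (hself : ∀ m, IsSeparated r m m) {p q x y z o : ι}
    (hall : ∀ m, m = p ∨ m = q ∨ m = x ∨ m = y ∨ m = z ∨ m = o)
    (hpx : IsSeparated r p x) (hpy : IsSeparated r p y) (hpz : IsSeparated r p z)
    (hqx : IsSeparated r q x) (hqy : IsSeparated r q y) (hqz : IsSeparated r q z)
    (hxy : IsSeparated r x y) (hxz : IsSeparated r x z) (hyz : IsSeparated r y z)
    {c : ι → ℝ} (hc : ∑ m, c m • r m = 0) (ho : c o = 0) (hne : c ≠ 0) :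
    (0 < c p ∧ 0 < c q ∧ c x < 0 ∧ c y < 0 ∧ c z < 0) ∨
      (c p < 0 ∧ c q < 0 ∧ 0 < c x ∧ 0 < c y ∧ 0 < c z) := by
  have hpos : ∀ {k l : ι}, IsSeparated r k l → ¬ ∀ m, m ≠ k → m ≠ l → c m ≤ 0 :=
    fun h hm => hne (h.eq_zero hself hc ho hm)
  have hneg : ∀ {k l : ι}, IsSeparated r k l → ¬ ∀ m, m ≠ k → m ≠ l → 0 ≤ c m := by
    intro k l h hm
    refine hne (neg_eq_zero.1
      (h.eq_zero hself (c := -c) ?_ (o := o) (by simp [ho]) fun m h₁ h₂ => ?_))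
    · simp [hc]
    · simpa using hm m h₁ h₂
  have hcov : ∀ {P : ι → Prop}, P p → P q → P x → P y → P z → P o → ∀ m, P m := by
    intro P h₁ h₂ h₃ h₄ h₅ h₆ m
    rcases hall m with rfl | rfl | rfl | rfl | rfl | rfl <;> assumption
  have hpos' : ∀ {k l : ι}, IsSeparated r k l → (p ≠ k → p ≠ l → c p ≤ 0) →
      (q ≠ k → q ≠ l → c q ≤ 0) → (x ≠ k → x ≠ l → c x ≤ 0) → (y ≠ k → y ≠ l → c y ≤ 0) →
      (z ≠ k → z ≠ l → c z ≤ 0) → False :=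
    fun h h₁ h₂ h₃ h₄ h₅ => hpos h (hcov h₁ h₂ h₃ h₄ h₅ fun _ _ => ho.le)
  have hneg' : ∀ {k l : ι}, IsSeparated r k l → (p ≠ k → p ≠ l → 0 ≤ c p) →
      (q ≠ k → q ≠ l → 0 ≤ c q) → (x ≠ k → x ≠ l → 0 ≤ c x) → (y ≠ k → y ≠ l → 0 ≤ c y) →
      (z ≠ k → z ≠ l → 0 ≤ c z) → False :=
    fun h h₁ h₂ h₃ h₄ h₅ => hneg h (hcov h₁ h₂ h₃ h₄ h₅ fun _ _ => ho.ge)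
  -- Two of `c x`, `c y`, `c z` have the same weak sign, so `p` and `q` cannot be on different sides.
  have hpq : ¬ (0 ≤ c p ∧ c q ≤ 0) := by
    rintro ⟨h₁, h₂⟩
    rcases le_total 0 (c x) with hx | hx <;> rcases le_total 0 (c y) with hy | hy <;>
      rcases le_total 0 (c z) with hz | hz <;>
      first
      | (refine hpos' hpx ?_ ?_ ?_ ?_ ?_ <;> intros <;> first | assumption | contradiction)
      | (refine hpos' hpy ?_ ?_ ?_ ?_ ?_ <;> intros <;> first | assumption | contradiction)
      | (refine hpos' hpz ?_ ?_ ?_ ?_ ?_ <;> intros <;> first | assumption | contradiction)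
      | (refine hneg' hqx ?_ ?_ ?_ ?_ ?_ <;> intros <;> first | assumption | contradiction)
      | (refine hneg' hqy ?_ ?_ ?_ ?_ ?_ <;> intros <;> first | assumption | contradiction)
      | (refine hneg' hqz ?_ ?_ ?_ ?_ ?_ <;> intros <;> first | assumption | contradiction)
  have hqp : ¬ (0 ≤ c q ∧ c p ≤ 0) := by
    rintro ⟨h₁, h₂⟩
    rcases le_total 0 (c x) with hx | hx <;> rcases le_total 0 (c y) with hy | hy <;>
      rcases le_total 0 (c z) with hz | hz <;>
      first
      | (refine hpos' hqx ?_ ?_ ?_ ?_ ?_ <;> intros <;> first | assumption | contradiction)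
      | (refine hpos' hqy ?_ ?_ ?_ ?_ ?_ <;> intros <;> first | assumption | contradiction)
      | (refine hpos' hqz ?_ ?_ ?_ ?_ ?_ <;> intros <;> first | assumption | contradiction)
      | (refine hneg' hpx ?_ ?_ ?_ ?_ ?_ <;> intros <;> first | assumption | contradiction)
      | (refine hneg' hpy ?_ ?_ ?_ ?_ ?_ <;> intros <;> first | assumption | contradiction)
      | (refine hneg' hpz ?_ ?_ ?_ ?_ ?_ <;> intros <;> first | assumption | contradiction)
  rcases lt_trichotomy (c p) 0 with h₁ | h₁ | h₁
  · have h₂ : c q < 0 := by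
      by_contra h
      exact hqp ⟨not_lt.1 h, h₁.le⟩
    refine Or.inr ⟨h₁, h₂, ?_, ?_, ?_⟩ <;> by_contra h <;> rw [not_lt] at h
    · exact hpos' hyz (fun _ _ => h₁.le) (fun _ _ => h₂.le) (fun _ _ => h) (by simp) (by simp)
    · exact hpos' hxz (fun _ _ => h₁.le) (fun _ _ => h₂.le) (by simp) (fun _ _ => h) (by simp)
    · exact hpos' hxy (fun _ _ => h₁.le) (fun _ _ => h₂.le) (by simp) (by simp) (fun _ _ => h)
  · rcases le_total 0 (c q) with h | h
    · exact absurd ⟨h, h₁.le⟩ hqp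
    · exact absurd ⟨h₁.ge, h⟩ hpq
  · have h₂ : 0 < c q := by
      by_contra h
      exact hpq ⟨h₁.le, not_lt.1 h⟩
    refine Or.inl ⟨h₁, h₂, ?_, ?_, ?_⟩ <;> by_contra h <;> rw [not_lt] at h
    · exact hneg' hyz (fun _ _ => h₁.le) (fun _ _ => h₂.le) (fun _ _ => h) (by simp) (by simp)
    · exact hneg' hxz (fun _ _ => h₁.le) (fun _ _ => h₂.le) (by simp) (fun _ _ => h) (by simp)
    · exact hneg' hxy (fun _ _ => h₁.le) (fun _ _ => h₂.le) (by simp) (by simp) (fun _ _ => h)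

/-- In rank at most four, any five of six rows are linearly dependent; the row `o` is the one left
out. -/
theorem exists_relation_of_rank_le_four {X Y : Type} [Finite X] [Fintype Y] (R : Matrix X Y ℝ)
    (hR : R.rank ≤ 4) (e : Fin 6 → X) (o : Fin 6) :
    ∃ c : Fin 6 → ℝ, ∑ m, c m • R (e m) = 0 ∧ c o = 0 ∧ c ≠ 0 := by
  let S := Submodule.span ℝ (Set.range R.row)
  let v : Fin 5 → S := fun i => ⟨R (e (o.succAbove i)), Submodule.subset_span ⟨_, rfl⟩⟩
  have hv : ¬ LinearIndependent ℝ v := by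
    intro h
    have h' := h.fintype_card_le_finrank
    rw [← Matrix.rank_eq_finrank_span_row, Fintype.card_fin] at h'
    omega
  obtain ⟨g, hg, i, hi⟩ := Fintype.not_linearIndependent_iff.1 hv
  refine ⟨o.insertNth 0 g, ?_, by simp, fun h => hi ?_⟩
  · have := congrArg Subtype.val hg
    rw [Fin.sum_univ_succAbove _ o]
    simpa [v] using this
  · have := congrFun h (o.succAbove i)
    simpa using this

/-- The pairs of six indices other than `{0, 2}` and `{3, 5}`, each listed once, together with the
singletons, listed as `(k, k)`. -/
def IsCommonPair (e : Fin 6 × Fin 6) : Prop :=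
  e.1 ≤ e.2 ∧ e ≠ (0, 2) ∧ e ≠ (3, 5)

instance : DecidablePred IsCommonPair := fun e => by unfold IsCommonPair; infer_instance

/-- The Radon partitions `02 | 134`, `02 | 145` and `35 | 014` are incompatible: eliminating `3` and
`5` from the three relations leaves a nontrivial relation on `0, 1, 2, 4`. -/
theorem four_lt_rank_of_isSeparated {X Y : Type} [Finite X] [Fintype Y] (R : Matrix X Y ℝ)
    (e : Fin 6 → X)
    (h : ∀ k l, IsCommonPair (k, l) → IsSeparated (fun m => R (e m)) k l) : 4 < R.rank := by
  by_contra hR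
  rw [not_lt] at hR
  have hself : ∀ m, IsSeparated (fun m => R (e m)) m m := fun m => h m m (by revert m; decide)
  have hsymm : ∀ k l, IsCommonPair (k, l) ∨ IsCommonPair (l, k) →
      IsSeparated (fun m => R (e m)) k l := by
    rintro k l (hkl | hkl)
    · exact h k l hkl
    · obtain ⟨y, hy⟩ := h l k hkl
      exact ⟨y, fun m => ⟨fun hm => (hy m).1 hm.symm, fun h₁ h₂ => (hy m).2 h₂ h₁⟩⟩
  have radon : ∀ p q x y z o : Fin 6,
      (∀ m, m = p ∨ m = q ∨ m = x ∨ m = y ∨ m = z ∨ m = o) →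
      (∀ k ∈ [p, q, x, y, z], ∀ l ∈ [x, y, z], IsCommonPair (k, l) ∨ IsCommonPair (l, k)) →
      ∀ c : Fin 6 → ℝ, ∑ m, c m • R (e m) = 0 → c o = 0 → c ≠ 0 →
      (0 < c p ∧ 0 < c q ∧ c x < 0 ∧ c y < 0 ∧ c z < 0) ∨
      (c p < 0 ∧ c q < 0 ∧ 0 < c x ∧ 0 < c y ∧ 0 < c z) := by
    intro p q x y z o hall hs c hc ho hne
    refine signs_of_relation (r := fun m => R (e m)) hself hall ?_ ?_ ?_ ?_ ?_ ?_ ?_ ?_ ?_ hc ho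
      hne <;>
      exact hsymm _ _ (hs _ (by simp) _ (by simp))
  have radon_pos : ∀ p q x y z o : Fin 6,
      (∀ m, m = p ∨ m = q ∨ m = x ∨ m = y ∨ m = z ∨ m = o) →
      (∀ k ∈ [p, q, x, y, z], ∀ l ∈ [x, y, z], IsCommonPair (k, l) ∨ IsCommonPair (l, k)) →
      ∃ c : Fin 6 → ℝ, ∑ m, c m • R (e m) = 0 ∧ c o = 0 ∧
      0 < c p ∧ 0 < c q ∧ c x < 0 ∧ c y < 0 ∧ c z < 0 := by
    intro p q x y z o hall hs
    obtain ⟨c, hc, ho, hne⟩ := exists_relation_of_rank_le_four R hR e o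
    rcases radon p q x y z o hall hs c hc ho hne with hsg | ⟨h₁, h₂, h₃, h₄, h₅⟩
    · exact ⟨c, hc, ho, hsg⟩
    · exact ⟨-c, by simp [hc], by simp [ho], by simpa, by simpa, by simpa, by simpa, by simpa⟩
  obtain ⟨u, hu, hu5, -, hu2, -, hu3, -⟩ := radon_pos 0 2 1 3 4 5 (by decide) (by decide)
  obtain ⟨v, hv, hv3, -, hv2, -, -, hv5⟩ := radon_pos 0 2 1 4 5 3 (by decide) (by decide)
  obtain ⟨w, hw, hw2, hw3, hw5, -⟩ := radon_pos 3 5 4 0 1 2 (by decide) (by decide)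
  let c : Fin 6 → ℝ := (u 3 * v 5) • w - (w 3 * v 5) • u - (w 5 * u 3) • v
  have hc : ∑ m, c m • R (e m) = 0 := by
    have : ∀ m, c m • R (e m) = (u 3 * v 5) • w m • R (e m) - (w 3 * v 5) • u m • R (e m) -
        (w 5 * u 3) • v m • R (e m) := by
      intro m
      simp only [c, Pi.sub_apply, Pi.smul_apply, smul_eq_mul, sub_smul, mul_smul]
    simp only [this, Finset.sum_sub_distrib, ← Finset.smul_sum, hu, hv, hw, smul_zero, sub_zero]
  have hc3 : c 3 = 0 := by simp [c, hv3]; ring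
  have hc5 : c 5 = 0 := by simp [c, hu5]; ring
  have hc2 : 0 < c 2 := by
    have h₁ : w 3 * v 5 * u 2 < 0 := mul_neg_of_neg_of_pos (mul_neg_of_pos_of_neg hw3 hv5) hu2
    have h₂ : w 5 * u 3 * v 2 < 0 := mul_neg_of_neg_of_pos (mul_neg_of_pos_of_neg hw5 hu3) hv2
    simp only [c, Pi.sub_apply, Pi.smul_apply, smul_eq_mul, hw2]
    linarith
  rcases radon 0 2 1 4 3 5 (by decide) (by decide) c hc hc5
    (fun h0 => hc2.ne' (by simp [h0])) with hs | hs
  · exact hs.2.2.2.2.ne hc3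
  · exact hs.2.2.2.2.ne' hc3

/-- Two decreasing chains `0, 1, 2` and `3, 4, 5`, the second below and to the left of the first.
The bounding rectangle of two of the points contains a third one only if the two are the ends of a
chain. -/
def twoChains : Fin 6 → ℕ × ℕ := ![(3, 5), (4, 4), (5, 3), (0, 2), (1, 1), (2, 0)]

theorem twoChains_mem_Icc_iff (e : {e // IsCommonPair e}) (m : Fin 6) :
    twoChains m ∈ Set.Icc (twoChains e.1.1 ⊓ twoChains e.1.2) (twoChains e.1.1 ⊔ twoChains e.1.2) ↔
      m = e.1.1 ∨ m = e.1.2 := by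
  revert m e
  simp only [Set.mem_Icc]
  decide +kernel

theorem pos_of_sign_eq_one {a : ℝ} (h : Real.sign a = 1) : 0 < a := by
  rcases lt_trichotomy a 0 with ha | rfl | ha
  · rw [Real.sign_of_neg ha] at h
    norm_num at h
  · norm_num at h
  · exact ha

theorem neg_of_sign_eq_neg_one {a : ℝ} (h : Real.sign a = -1) : a < 0 :=
  neg_pos.1 (pos_of_sign_eq_one (by rw [Real.sign_neg, h, neg_neg]))

/-- The incidence graph of the points `twoChains` and the bounding rectangles of all common
pairs. -/
theorem exists_signRank_eq_five :
    ∃ G ∈ k22FreePointBoxGraphs, signRank G.adjMatrix = 5 := by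
  let G := gridGraph twoChains
    (fun e : {e // IsCommonPair e} => twoChains e.1.1 ⊓ twoChains e.1.2)
    (fun e => twoChains e.1.1 ⊔ twoChains e.1.2)
  have hadj : ∀ m e, G.Adj m e ↔ m = e.1.1 ∨ m = e.1.2 := fun m e => twoChains_mem_Icc_iff e m
  have hG : G ∈ pointBoxGraphs := by
    refine gridGraph_mem_pointBoxGraphs (by decide) (fun e => inf_le_sup) ?_
    rintro ⟨⟨k, l⟩, hkl⟩ ⟨⟨k', l'⟩, hkl'⟩ hm
    have hm' : ∀ m, (m = k ∨ m = l) ↔ (m = k' ∨ m = l') := fun m =>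
      (twoChains_mem_Icc_iff ⟨(k, l), hkl⟩ m).symm.trans
        ((hm m).trans (twoChains_mem_Icc_iff ⟨(k', l'), hkl'⟩ m))
    have h₁ := hm' k
    have h₂ := hm' l
    have h₃ := hm' k'
    have h₄ := hm' l'
    clear hm hm' hadj
    have h₅ := hkl.1
    have h₆ := hkl'.1
    grind
  refine ⟨G, ⟨hG, ?_⟩, (signRank_le_five hG).antisymm ?_⟩
  · rintro x₁ x₂ ⟨⟨k, l⟩, hkl⟩ ⟨⟨k', l'⟩, hkl'⟩ hx hy hK
    simp only [hadj] at hK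
    have h₅ := hkl.1
    have h₆ := hkl'.1
    grind
  · obtain ⟨R, hR, hs⟩ := exists_rank_eq_signRank G.adjMatrix
    rw [← hR]
    refine four_lt_rank_of_isSeparated R id fun k l hkl => ⟨⟨(k, l), hkl⟩, fun m => ⟨?_, ?_⟩⟩
    · intro hm
      have h₁ := hs m ⟨(k, l), hkl⟩
      rw [show G.adjMatrix m ⟨(k, l), hkl⟩ = 1 by simp [BipGraph.adjMatrix, hadj, hm]] at h₁
      exact pos_of_sign_eq_one (by simpa using h₁)
    · intro h₁ h₂
      have h₃ := hs m ⟨(k, l), hkl⟩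
      rw [show G.adjMatrix m ⟨(k, l), hkl⟩ = -1 by simp [BipGraph.adjMatrix, hadj, h₁, h₂]] at h₃
      exact neg_of_sign_eq_neg_one (by simpa using h₃)

/-! ### Equality queries as colour comparisons -/

/-- The matrix that compares a colour of the row with a colour of the column. -/
def colourMatrix {X Y C : Type} [DecidableEq C] (f : X → C) (g : Y → C) : Matrix X Y ℤˣ :=
  Matrix.of fun x y => if f x = g y then 1 else -1

theorem QuerySet.exists_eq_colourMatrix {X Y : Type} {Q : Matrix X Y ℤˣ}
    (h : QuerySet EqualityProblem X Y Q) :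
    ∃ (N : ℕ) (f : X → Fin N) (g : Y → Fin N), Q = colourMatrix f g := by
  induction h with
  | base h =>
    obtain ⟨N⟩ := h
    exact ⟨N, id, id, rfl⟩
  | permute e e' _ ih =>
    obtain ⟨N, f, g, rfl⟩ := ih
    exact ⟨N, f ∘ e, g ∘ e', rfl⟩
  | sub S T _ ih =>
    obtain ⟨N, f, g, rfl⟩ := ih
    exact ⟨N, fun x => f x, fun y => g y, rfl⟩
  | dupRow x _ ih =>
    obtain ⟨N, f, g, rfl⟩ := ih
    exact ⟨N, fun o => f (o.getD x), g, rfl⟩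
  | dupCol y _ ih =>
    obtain ⟨N, f, g, rfl⟩ := ih
    exact ⟨N, f, fun o => g (o.getD y), rfl⟩

/-- Moving the new point of `Option β` outside of the sum. -/
def sumOptionEquiv (α β : Type) : α ⊕ Option β ≃ Option (α ⊕ β) where
  toFun := Sum.elim (fun x => some (.inl x)) fun o => o.elim none fun z => some (.inr z)
  invFun o := o.elim (.inr none) (Sum.elim .inl fun z => .inr (some z))
  left_inv := by rintro (x | _ | z) <;> rfl
  right_inv := by rintro (_ | x | z) <;> rfl

/-- Query sets contain all finite blow-ups of the rows: append the new rows one at a time as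
duplicates, and then delete the old ones. -/
theorem QuerySet.submatrix_left {P : MatrixSet} {X Y X' : Type} [Finite X'] {Q : Matrix X Y ℤˣ}
    (h : QuerySet P X Y Q) : ∀ f : X' → X, QuerySet P X' Y (Q.submatrix f id) := by
  have key : ∀ f : X' → X, QuerySet P (X ⊕ X') Y (Q.submatrix (Sum.elim id f) id) := by
    induction X' using Finite.induction_empty_option with
    | of_equiv e ih =>
      intro f
      convert (ih (f ∘ e)).permute ((Equiv.refl X).sumCongr e.symm) (Equiv.refl Y) using 1
      ext (x | x) y <;> simp
    | h_empty =>
      intro f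
      convert h.permute (Equiv.sumEmpty X PEmpty) (Equiv.refl Y) using 1
      ext (x | x) y
      · simp
      · exact x.elim
    | h_option ih =>
      intro f
      convert ((ih (f ∘ some)).dupRow (.inl (f none))).permute
        (sumOptionEquiv X _) (Equiv.refl Y) using 1
      ext (x | _ | z) y <;> simp [sumOptionEquiv]
  intro f
  have h' := (key f).sub (Set.range Sum.inr) Set.univ
  convert h'.permute (Equiv.ofInjective _ Sum.inr_injective) (Equiv.Set.univ Y).symm using 1
  ext x y
  simp

theorem QuerySet.submatrix_right {P : MatrixSet} {X Y Y' : Type} [Finite Y'] {Q : Matrix X Y ℤˣ}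
    (h : QuerySet P X Y Q) : ∀ g : Y' → Y, QuerySet P X Y' (Q.submatrix id g) := by
  have key : ∀ g : Y' → Y, QuerySet P X (Y ⊕ Y') (Q.submatrix id (Sum.elim id g)) := by
    induction Y' using Finite.induction_empty_option with
    | of_equiv e ih =>
      intro f
      convert (ih (f ∘ e)).permute (Equiv.refl X) ((Equiv.refl Y).sumCongr e.symm) using 1
      ext x (y | y) <;> simp
    | h_empty =>
      intro f
      convert h.permute (Equiv.refl X) (Equiv.sumEmpty Y PEmpty) using 1
      ext x (y | y)
      · simp
      · exact y.elim
    | h_option ih =>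
      intro f
      convert ((ih (f ∘ some)).dupCol (.inl (f none))).permute
        (Equiv.refl X) (sumOptionEquiv Y _) using 1
      ext x (y | _ | z) <;> simp [sumOptionEquiv]
  intro g
  have h' := (key g).sub Set.univ (Set.range Sum.inr)
  convert h'.permute (Equiv.Set.univ X).symm (Equiv.ofInjective _ Sum.inr_injective) using 1
  ext x y
  simp

theorem querySet_colourMatrix {X Y : Type} [Finite X] [Finite Y] {N : ℕ} (f : X → Fin N)
    (g : Y → Fin N) : QuerySet EqualityProblem X Y (colourMatrix f g) :=
  ((QuerySet.base (P := EqualityProblem) (.mk N)).submatrix_left f).submatrix_right g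

/-- Going through the rows one at a time: the query for the row `a` asks whether `x = a` and
`M x y = 1`. -/
theorem exists_oracleProtocol {X Y : Type} [Finite X] [Finite Y] (M : Matrix X Y ℤˣ)
    (s : Finset X) : ∃ T : OracleProtocol EqualityProblem X Y, T.depth = s.card ∧
      ∀ x y, T.output x y = 1 ↔ x ∈ s ∧ M x y = 1 := by
  classical
  induction s using Finset.induction_on with
  | empty =>
    exact ⟨.leaf (-1), rfl, by simp [OracleProtocol.output]⟩
  | insert a s ha ih =>
    obtain ⟨T, hT, hout⟩ := ih
    let f : X → Fin 3 := fun x => if x = a then 0 else 1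
    let g : Y → Fin 3 := fun y => if M a y = 1 then 0 else 2
    refine ⟨.node (colourMatrix f g) (querySet_colourMatrix f g) T (.leaf 1), ?_, fun x y => ?_⟩
    · simp [OracleProtocol.depth, hT, Finset.card_insert_of_notMem ha]
    · by_cases hx : x = a
      · subst hx
        by_cases hM : M x y = 1 <;>
          simp [OracleProtocol.output, colourMatrix, f, g, hM, hout]
      · by_cases hM : M a y = 1 <;>
          simp [OracleProtocol.output, colourMatrix, f, g, hM, hout, hx]

theorem exists_computes_depth_le_card {X Y : Type} [Fintype X] [Finite Y] (M : Matrix X Y ℤˣ) :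
    ∃ T : OracleProtocol EqualityProblem X Y, T.Computes M ∧ T.depth = Fintype.card X := by
  obtain ⟨T, hT, hout⟩ := exists_oracleProtocol M Finset.univ
  refine ⟨T, fun x y => ?_, by simpa using hT⟩
  have := hout x y
  rcases Int.units_eq_one_or (M x y) with h | h <;>
    rcases Int.units_eq_one_or (T.output x y) with h' | h' <;> simp_all

theorem oracleCost_le_card {X Y : Type} [Fintype X] [Finite Y] (M : Matrix X Y ℤˣ) :
    oracleCost EqualityProblem M ≤ Fintype.card X :=
  Nat.sInf_le (exists_computes_depth_le_card M)

theorem exists_computes_depth_eq_oracleCost {X Y : Type} [Finite X] [Finite Y]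
    (M : Matrix X Y ℤˣ) : ∃ T : OracleProtocol EqualityProblem X Y,
      T.Computes M ∧ T.depth = oracleCost EqualityProblem M := by
  have := Fintype.ofFinite X
  exact Nat.sInf_mem (s := {c | ∃ T : OracleProtocol EqualityProblem X Y,
    T.Computes M ∧ T.depth = c}) ⟨_, exists_computes_depth_le_card M⟩

/-! ### Cheap protocols accept few entries -/

open Finset in
/-- A random set of colours contains `a` and not `b` with probability `1 / 4`. -/
theorem card_filter_mem_notMem {C : Type} [Fintype C] [DecidableEq C] {a b : C} (h : a ≠ b) :
    4 * #{s : Finset C | a ∈ s ∧ b ∉ s} = 2 ^ Fintype.card C := by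
  have hsub : ({a} : Finset C) ⊆ univ.erase b := by simp [h]
  have heq : ({s : Finset C | a ∈ s ∧ b ∉ s} : Finset (Finset C)) = Icc {a} (univ.erase b) := by
    ext s
    simp [Finset.subset_erase]
  have hcard : 2 ≤ Fintype.card C := by
    simpa [card_pair h] using card_le_univ ({a, b} : Finset C)
  rw [heq, card_Icc_finset hsub, card_singleton, card_erase_of_mem (mem_univ _), card_univ]
  obtain ⟨k, hk⟩ := Nat.exists_eq_add_of_le hcard
  rw [hk, show 2 + k - 1 - 1 = k by omega, pow_add]
  norm_num

open Finset in
/-- A rectangle without `K_{2,2}` whose entries are all `1` is a star. -/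
theorem card_mul_card_le_of_k22Free {X Y : Type} {A : Finset X} {B : Finset Y}
    (h : ∀ x₁ ∈ A, ∀ x₂ ∈ A, ∀ y₁ ∈ B, ∀ y₂ ∈ B, x₁ ≠ x₂ → y₁ = y₂) :
    #A * #B ≤ #A + #B := by
  rcases le_or_gt #A 1 with hA | hA
  · nlinarith
  · obtain ⟨x₁, h₁, x₂, h₂, hne⟩ := one_lt_card.1 hA
    have hB : #B ≤ 1 := card_le_one.2 fun y₁ hy₁ y₂ hy₂ => h x₁ h₁ x₂ h₂ y₁ hy₁ y₂ hy₂ hne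
    nlinarith

open Finset in
/-- If the entries of `A × B` accepted by `T` are `K_{2,2}`-free, there are at most
`5 ^ T.depth * (#A + #B)` of them. At a node, the pairs of equal colours form disjoint rectangles,
which contribute one copy of the bound for the right subtree. A pair of distinct colours lies in
the rectangle "row colour in `s`, column colour not in `s`" for a quarter of the sets `s` of colours,
so such pairs contribute at most four copies of the bound for the left subtree. -/
theorem OracleProtocol.card_output_eq_one_le {X Y : Type} [DecidableEq X] [DecidableEq Y]
    (T : OracleProtocol EqualityProblem X Y) :
    ∀ (A : Finset X) (B : Finset Y),
      (∀ x₁ ∈ A, ∀ x₂ ∈ A, ∀ y₁ ∈ B, ∀ y₂ ∈ B, x₁ ≠ x₂ → y₁ ≠ y₂ →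
        ¬ (T.output x₁ y₁ = 1 ∧ T.output x₁ y₂ = 1 ∧ T.output x₂ y₁ = 1 ∧ T.output x₂ y₂ = 1)) →
      #{z ∈ A ×ˢ B | T.output z.1 z.2 = 1} ≤ 5 ^ T.depth * (#A + #B) := by
  induction T with
  | leaf b =>
    intro A B hK
    rcases Int.units_eq_one_or b with rfl | rfl
    · simp only [output, and_self, not_true] at hK
      simp only [output, depth, filter_true, card_product, pow_zero, one_mul]
      refine card_mul_card_le_of_k22Free fun x₁ h₁ x₂ h₂ y₁ h₃ y₂ h₄ hx => ?_
      by_contra hy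
      exact hK x₁ h₁ x₂ h₂ y₁ h₃ y₂ h₄ hx hy
    · simp [output]
  | node Q hQ L R ihL ihR =>
    intro A B hK
    obtain ⟨N, f, g, rfl⟩ := hQ.exists_eq_colourMatrix
    have hout : ∀ x y, (OracleProtocol.node (colourMatrix f g) hQ L R).output x y =
        if f x = g y then R.output x y else L.output x y := by
      intro x y
      by_cases h : f x = g y <;> simp [output, colourMatrix, h]
    simp only [hout] at hK ⊢
    set K := 5 ^ max L.depth R.depth with hKdef
    have hR : #{z ∈ A ×ˢ B | f z.1 = g z.2 ∧ R.output z.1 z.2 = 1} ≤ K * (#A + #B) := by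
      have hc : ∀ c, #{z ∈ {z ∈ A ×ˢ B | f z.1 = g z.2 ∧ R.output z.1 z.2 = 1} | f z.1 = c} ≤
          K * (#{x ∈ A | f x = c} + #{y ∈ B | g y = c}) := by
        intro c
        calc _ ≤ #{z ∈ {x ∈ A | f x = c} ×ˢ {y ∈ B | g y = c} | R.output z.1 z.2 = 1} := by
              refine card_le_card fun z hz => ?_
              simp only [mem_filter, mem_product] at hz ⊢
              grind
          _ ≤ 5 ^ R.depth * (#{x ∈ A | f x = c} + #{y ∈ B | g y = c}) := by
              refine ihR _ _ fun x₁ h₁ x₂ h₂ y₁ h₃ y₂ h₄ hx hy => ?_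
              rw [mem_filter] at h₁ h₂ h₃ h₄
              have := hK x₁ h₁.1 x₂ h₂.1 y₁ h₃.1 y₂ h₄.1 hx hy
              simpa only [h₁.2, h₂.2, h₃.2, h₄.2, if_true] using this
          _ ≤ _ := Nat.mul_le_mul_right _ (Nat.pow_le_pow_right (by norm_num) (le_max_right _ _))
      calc _ = ∑ c, #{z ∈ {z ∈ A ×ˢ B | f z.1 = g z.2 ∧ R.output z.1 z.2 = 1} | f z.1 = c} :=
            card_eq_sum_card_fiberwise (f := fun z : X × Y => f z.1) (by simp [Set.MapsTo])
        _ ≤ ∑ c, K * (#{x ∈ A | f x = c} + #{y ∈ B | g y = c}) := sum_le_sum fun c _ => hc c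
        _ = K * (#A + #B) := by
            rw [← mul_sum, sum_add_distrib, ← card_eq_sum_card_fiberwise (by simp [Set.MapsTo]),
              ← card_eq_sum_card_fiberwise (by simp [Set.MapsTo])]
    have hL : #{z ∈ A ×ˢ B | f z.1 ≠ g z.2 ∧ L.output z.1 z.2 = 1} ≤ 4 * (K * (#A + #B)) := by
      set E := {z ∈ A ×ˢ B | f z.1 ≠ g z.2 ∧ L.output z.1 z.2 = 1} with hE
      have hs : ∀ s : Finset (Fin N), #{z ∈ E | f z.1 ∈ s ∧ g z.2 ∉ s} ≤ K * (#A + #B) := by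
        intro s
        calc _ ≤ #{z ∈ {x ∈ A | f x ∈ s} ×ˢ {y ∈ B | g y ∉ s} | L.output z.1 z.2 = 1} := by
              refine card_le_card fun z hz => ?_
              simp only [hE, mem_filter, mem_product] at hz ⊢
              grind
          _ ≤ 5 ^ L.depth * (#{x ∈ A | f x ∈ s} + #{y ∈ B | g y ∉ s}) := by
              refine ihL _ _ fun x₁ h₁ x₂ h₂ y₁ h₃ y₂ h₄ hx hy => ?_
              rw [mem_filter] at h₁ h₂ h₃ h₄
              have hne : ∀ {c d}, c ∈ s → d ∉ s → c ≠ d := fun hc hd h => hd (h ▸ hc)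
              have := hK x₁ h₁.1 x₂ h₂.1 y₁ h₃.1 y₂ h₄.1 hx hy
              simpa only [if_neg (hne h₁.2 h₃.2), if_neg (hne h₁.2 h₄.2), if_neg (hne h₂.2 h₃.2),
                if_neg (hne h₂.2 h₄.2)] using this
          _ ≤ K * (#A + #B) := Nat.mul_le_mul
              (Nat.pow_le_pow_right (by norm_num) (le_max_left _ _))
              (add_le_add (card_filter_le _ _) (card_filter_le _ _))
      have hdouble : ∑ s : Finset (Fin N), #{z ∈ E | f z.1 ∈ s ∧ g z.2 ∉ s} =
          ∑ z ∈ E, #{s : Finset (Fin N) | f z.1 ∈ s ∧ g z.2 ∉ s} :=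
        sum_card_bipartiteAbove_eq_sum_card_bipartiteBelow
          (fun (s : Finset (Fin N)) (z : X × Y) => f z.1 ∈ s ∧ g z.2 ∉ s)
      have hfour : 4 * ∑ z ∈ E, #{s : Finset (Fin N) | f z.1 ∈ s ∧ g z.2 ∉ s} = #E * 2 ^ N := by
        rw [mul_sum, sum_congr rfl fun z hz => card_filter_mem_notMem (mem_filter.1 hz).2.1]
        simp
      have hsum : ∑ s : Finset (Fin N), #{z ∈ E | f z.1 ∈ s ∧ g z.2 ∉ s} ≤
          2 ^ N * (K * (#A + #B)) := by
        refine (sum_le_sum fun s _ => hs s).trans ?_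
        simp
      refine Nat.le_of_mul_le_mul_right (c := 2 ^ N) ?_ (by positivity)
      rw [← hfour, ← hdouble]
      calc _ ≤ 4 * (2 ^ N * (K * (#A + #B))) := Nat.mul_le_mul_left _ hsum
        _ = _ := by ring
    calc _ ≤ #({z ∈ A ×ˢ B | f z.1 = g z.2 ∧ R.output z.1 z.2 = 1} ∪
          {z ∈ A ×ˢ B | f z.1 ≠ g z.2 ∧ L.output z.1 z.2 = 1}) := by
          refine card_le_card fun z hz => ?_
          simp only [mem_union, mem_filter] at hz ⊢
          by_cases h : f z.1 = g z.2
          · exact Or.inl ⟨hz.1, h, by simpa [h] using hz.2⟩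
          · exact Or.inr ⟨hz.1, h, by simpa [h] using hz.2⟩
      _ ≤ K * (#A + #B) + 4 * (K * (#A + #B)) := (card_union_le _ _).trans (add_le_add hR hL)
      _ = 5 ^ (max L.depth R.depth + 1) * (#A + #B) := by rw [pow_succ, ← hKdef]; ring

open Finset Classical in
/-- A `K_{2,2}`-free graph with a dense induced subgraph is expensive. -/
theorem lt_oracleCost_of_dense {G : BipGraph} (hK : G.K22Free) (A : Finset G.X) (B : Finset G.Y)
    (d : ℕ) (hd : 5 ^ d * (#A + #B) < #{z ∈ A ×ˢ B | G.Adj z.1 z.2}) :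
    d < oracleCost EqualityProblem G.adjMatrix := by
  obtain ⟨T, hT, hdepth⟩ := exists_computes_depth_eq_oracleCost G.adjMatrix
  have hadj : ∀ x y, T.output x y = 1 ↔ G.Adj x y := by
    intro x y
    rw [hT x y]
    by_cases h : G.Adj x y <;> simp [BipGraph.adjMatrix, h]
  have hcard := T.card_output_eq_one_le A B fun x₁ _ x₂ _ y₁ _ y₂ _ hx hy => by
    simpa only [hadj] using hK x₁ x₂ y₁ y₂ hx hy
  simp only [hadj] at hcard
  rw [← hdepth]
  by_contra hle
  exact absurd (hd.trans_le hcard) (not_lt.2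
    (Nat.mul_le_mul_right _ (Nat.pow_le_pow_right (by norm_num) (not_lt.1 hle))))

/-! ### Words and combinatorial lines -/

theorem val_finFunctionFinEquiv_div_mod {b k : ℕ} (w : Fin k → Fin b) (i : Fin k) :
    (finFunctionFinEquiv w : ℕ) / b ^ (i : ℕ) % b = w i := by
  rw [← finFunctionFinEquiv_symm_apply_val, Equiv.symm_apply_apply]

theorem finFunctionFinEquiv_div_eq_div_iff {b k : ℕ} (hb : 0 < b) (w u : Fin k → Fin b) (m : ℕ) :
    (finFunctionFinEquiv w : ℕ) / b ^ m = (finFunctionFinEquiv u : ℕ) / b ^ m ↔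
      ∀ i : Fin k, m ≤ i → w i = u i := by
  constructor
  · intro h i hi
    obtain ⟨j, hj⟩ := Nat.exists_eq_add_of_le hi
    have hdiv : ∀ n : ℕ, n / b ^ (i : ℕ) = n / b ^ m / b ^ j := fun n => by
      rw [Nat.div_div_eq_div_mul, ← pow_add, hj]
    ext
    rw [← val_finFunctionFinEquiv_div_mod w i, ← val_finFunctionFinEquiv_div_mod u i, hdiv, h,
      ← hdiv]
  · have hlt : ∀ (w : Fin k → Fin b) (m : ℕ), k ≤ m → (finFunctionFinEquiv w : ℕ) / b ^ m = 0 :=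
      fun w m hm => Nat.div_eq_of_lt
        ((finFunctionFinEquiv w).2.trans_le (Nat.pow_le_pow_right hb hm))
    have key : ∀ d m, k ≤ m + d → (∀ i : Fin k, m ≤ i → w i = u i) →
        (finFunctionFinEquiv w : ℕ) / b ^ m = (finFunctionFinEquiv u : ℕ) / b ^ m := by
      intro d
      induction d with
      | zero => exact fun m hm _ => by rw [hlt w m hm, hlt u m hm]
      | succ d ih =>
        intro m hm h
        rcases le_or_gt k m with hkm | hkm
        · rw [hlt w m hkm, hlt u m hkm]
        · have h₁ := ih (m + 1) (by omega) fun i hi => h i (by omega)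
          have h₂ := val_finFunctionFinEquiv_div_mod w ⟨m, hkm⟩
          rw [h ⟨m, hkm⟩ le_rfl, ← val_finFunctionFinEquiv_div_mod u ⟨m, hkm⟩] at h₂
          rw [pow_succ, ← Nat.div_div_eq_div_mul, ← Nat.div_div_eq_div_mul] at h₁
          rw [← Nat.div_add_mod ((finFunctionFinEquiv w : ℕ) / b ^ m) b, h₁, h₂, Nat.div_add_mod]
    exact key k m (Nat.le_add_left _ _)

/-- The lattice point of a word: the word and its reversal, read as numbers in base `b` with the
last letter as leading digit. -/
def wordPoint {b k : ℕ} (w : Fin k → Fin b) : ℕ × ℕ :=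
  (finFunctionFinEquiv w, finFunctionFinEquiv (w ∘ Fin.rev))

theorem wordPoint_injective {b k : ℕ} :
    Function.Injective (wordPoint : (Fin k → Fin b) → ℕ × ℕ) := fun _ _ h =>
  finFunctionFinEquiv.injective (Fin.ext (congrArg Prod.fst h))

/-- A combinatorial line in direction `s`, given by the letters of its words outside of `s`. -/
abbrev WordLine (b n : ℕ) : Type := Fin (n + 1) × (Fin n → Fin b)

/-- The widths, minus `1`, of the box of a line in direction `s`. The letters after `s`, which are
constant on the line, are the leading digits of the first coordinate, and the letters before `s`
are the leading digits of the second; the remaining digits are arbitrary in the box. -/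
def lineWidth (b : ℕ) {n : ℕ} (s : Fin (n + 1)) : ℕ × ℕ :=
  (b ^ ((s : ℕ) + 1) - 1, b ^ ((s.rev : ℕ) + 1) - 1)

/-- The lower left corner of the box of a line. -/
def lineLo {c n : ℕ} (l : WordLine (c + 1) n) : ℕ × ℕ :=
  let u : Fin (n + 1) → Fin (c + 1) := l.1.insertNth 0 l.2
  ((c + 1) ^ ((l.1 : ℕ) + 1) * ((wordPoint u).1 / (c + 1) ^ ((l.1 : ℕ) + 1)),
    (c + 1) ^ ((l.1.rev : ℕ) + 1) * ((wordPoint u).2 / (c + 1) ^ ((l.1.rev : ℕ) + 1)))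

/-- The upper right corner of the box of a line. -/
def lineHi {c n : ℕ} (l : WordLine (c + 1) n) : ℕ × ℕ := lineLo l + lineWidth (c + 1) l.1

theorem mem_Icc_mul_iff_div_eq {B n q : ℕ} (hB : 0 < B) :
    (B * q ≤ n ∧ n ≤ B * q + (B - 1)) ↔ n / B = q := by
  rw [Nat.div_eq_iff hB, mul_comm]
  omega

/-- The box of a line contains exactly the points of its words. -/
theorem wordPoint_mem_Icc_iff {c n : ℕ} (w : Fin (n + 1) → Fin (c + 1))
    (l : WordLine (c + 1) n) :
    wordPoint w ∈ Set.Icc (lineLo l) (lineHi l) ↔ l.1.removeNth w = l.2 := by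
  obtain ⟨s, v⟩ := l
  set u : Fin (n + 1) → Fin (c + 1) := s.insertNth 0 v with hu
  have hpos : ∀ m, 0 < (c + 1) ^ m := fun m => by positivity
  have h₁ : wordPoint w ∈ Set.Icc (lineLo (s, v)) (lineHi (s, v)) ↔
      (wordPoint w).1 / (c + 1) ^ ((s : ℕ) + 1) = (wordPoint u).1 / (c + 1) ^ ((s : ℕ) + 1) ∧
      (wordPoint w).2 / (c + 1) ^ ((s.rev : ℕ) + 1) =
        (wordPoint u).2 / (c + 1) ^ ((s.rev : ℕ) + 1) := by
    rw [← mem_Icc_mul_iff_div_eq (hpos _), ← mem_Icc_mul_iff_div_eq (hpos _), Set.mem_Icc,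
      Prod.le_def, Prod.le_def, and_and_and_comm]
    rfl
  rw [h₁]
  simp only [wordPoint]
  rw [finFunctionFinEquiv_div_eq_div_iff c.succ_pos, finFunctionFinEquiv_div_eq_div_iff c.succ_pos]
  constructor
  · rintro ⟨hx, hy⟩
    funext j
    have hne : s.succAbove j ≠ s := Fin.succAbove_ne s j
    have hw : w (s.succAbove j) = u (s.succAbove j) := by
      rcases lt_or_gt_of_ne hne with h | h
      · have := hy (s.succAbove j).rev (Nat.succ_le_of_lt (Fin.rev_lt_rev.2 h))
        simpa using this
      · exact hx _ (Nat.succ_le_of_lt h)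
    simpa [Fin.removeNth, hu] using hw
  · intro h
    have hw : ∀ i, i ≠ s → w i = u i := by
      intro i hi
      obtain ⟨j, rfl⟩ := Fin.exists_succAbove_eq hi
      simpa [Fin.removeNth, hu] using congrFun h j
    refine ⟨fun i hi => hw i ?_, fun i hi => hw i.rev ?_⟩
    · rintro rfl
      omega
    · rintro rfl
      rw [Fin.rev_rev] at hi
      omega

/-- Two distinct words lie on at most one line. -/
theorem WordLine.eq_of_mem_of_mem {b n : ℕ} {w₁ w₂ : Fin (n + 1) → Fin b} (hw : w₁ ≠ w₂)
    {l l' : WordLine b n} (h₁ : l.1.removeNth w₁ = l.2) (h₂ : l.1.removeNth w₂ = l.2)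
    (h₁' : l'.1.removeNth w₁ = l'.2) (h₂' : l'.1.removeNth w₂ = l'.2) : l = l' := by
  have key : ∀ l : WordLine b n, l.1.removeNth w₁ = l.2 → l.1.removeNth w₂ = l.2 →
      ∀ i, i ≠ l.1 → w₁ i = w₂ i := by
    intro l h h' i hi
    obtain ⟨j, rfl⟩ := Fin.exists_succAbove_eq hi
    exact congrFun (h.trans h'.symm) j
  have hs : l.1 = l'.1 := by
    by_contra hne
    refine hw (funext fun i => ?_)
    by_cases hi : i = l.1
    · exact key l' h₁' h₂' i fun h => hne (hi.symm.trans h)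
    · exact key l h₁ h₂ i hi
  refine Prod.ext hs ?_
  rw [← h₁, ← h₁', hs]

/-- Each of the `b ^ b` words of length `b` over `b` letters lies on `b` of the `b ^ b` lines, which
are too many incidences for a protocol of depth `d` once `2 * 5 ^ d < b`; isolated points adjust the number of vertices. -/
theorem exists_lt_oracleCost (d t : ℕ) : ∃ G ∈ k22FreePointBoxGraphs,
    G.numVertices = 2 * (2 * 5 ^ d + 1) ^ (2 * 5 ^ d + 1) + t ∧
      d < oracleCost EqualityProblem G.adjMatrix := by
  classical
  set c := 2 * 5 ^ d with hc
  have hcpos : 0 < c := by positivity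
  have hK : (gridGraph (wordPoint : (Fin (c + 1) → Fin (c + 1)) → ℕ × ℕ)
      (lineLo : WordLine (c + 1) c → ℕ × ℕ) lineHi).K22Free := by
    rintro w₁ w₂ l₁ l₂ hw hl ⟨h₁, h₂, h₃, h₄⟩
    exact hl (WordLine.eq_of_mem_of_mem hw ((wordPoint_mem_Icc_iff _ _).1 h₁)
      ((wordPoint_mem_Icc_iff _ _).1 h₃) ((wordPoint_mem_Icc_iff _ _).1 h₂)
      ((wordPoint_mem_Icc_iff _ _).1 h₄))
  have hinj : ∀ l l' : WordLine (c + 1) c,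
      (∀ w : Fin (c + 1) → Fin (c + 1), wordPoint w ∈ Set.Icc (lineLo l) (lineHi l) ↔
        wordPoint w ∈ Set.Icc (lineLo l') (lineHi l')) → l = l' := by
    intro l l' h
    simp only [wordPoint_mem_Icc_iff] at h
    -- The alphabet has two letters, so a line has two words.
    have hne : l.1.insertNth (α := fun _ => Fin (c + 1)) 0 l.2 ≠
        l.1.insertNth (α := fun _ => Fin (c + 1)) (Fin.last c) l.2 := by
      intro h'
      have := congrArg Fin.val (congrFun h' l.1)
      simp only [Fin.insertNth_apply_same, Fin.val_zero, Fin.val_last] at this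
      omega
    have h₁ := Fin.removeNth_insertNth (α := fun _ => Fin (c + 1)) l.1 0 l.2
    have h₂ := Fin.removeNth_insertNth (α := fun _ => Fin (c + 1)) l.1 (Fin.last c) l.2
    exact WordLine.eq_of_mem_of_mem hne h₁ h₂ ((h _).1 h₁) ((h _).1 h₂)
  obtain ⟨q, hq, hmem⟩ := exists_gridGraph_sum_fin wordPoint_injective
    (fun l => le_self_add) hinj hK t
  refine ⟨_, hmem, ?_, ?_⟩
  · simp only [BipGraph.numVertices, Fintype.card_sum, Fintype.card_fin, Fintype.card_prod,
      Fintype.card_pi, Finset.prod_const, Finset.card_univ]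
    ring
  · refine lt_oracleCost_of_dense hmem.2 (Finset.univ.map Function.Embedding.inl) Finset.univ d ?_
    let i : (Fin (c + 1) → Fin (c + 1)) × Fin (c + 1) →
        ((Fin (c + 1) → Fin (c + 1)) ⊕ Fin t) × WordLine (c + 1) c :=
      fun z => (.inl z.1, z.2, z.2.removeNth z.1)
    have hi : Function.Injective i := by
      rintro ⟨w, s⟩ ⟨w', s'⟩ h
      simp only [i, Prod.mk.injEq, Sum.inl.injEq] at h
      exact Prod.ext h.1 h.2.1
    have hcard := Finset.card_le_card_of_injOn (s := Finset.univ)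
      (t := (Finset.univ.map Function.Embedding.inl ×ˢ Finset.univ).filter
        fun z : ((Fin (c + 1) → Fin (c + 1)) ⊕ Fin t) × WordLine (c + 1) c =>
          q z.1 ∈ Set.Icc (lineLo z.2) (lineHi z.2)) i (fun z _ => by
        simp [i, hq, -Set.mem_Icc, wordPoint_mem_Icc_iff]) hi.injOn
    refine lt_of_lt_of_le ?_ (hcard.trans_eq (by congr))
    simp only [Finset.card_map, Finset.card_univ, Fintype.card_fin, Fintype.card_prod,
      Fintype.card_pi, Finset.prod_const]
    have hp : 0 < (c + 1) ^ (c + 1) := by positivity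
    calc 5 ^ d * ((c + 1) ^ (c + 1) + (c + 1) * (c + 1) ^ c) = c * (c + 1) ^ (c + 1) := by
          rw [hc]; ring
      _ < (c + 1) ^ (c + 1) * (c + 1) := by nlinarith

theorem tendsto_equalityCost_k22FreePointBoxGraphs :
    Filter.Tendsto (equalityCost k22FreePointBoxGraphs) Filter.atTop Filter.atTop := by
  refine Filter.tendsto_atTop.2 fun d => ?_
  filter_upwards [Filter.eventually_ge_atTop (2 * (2 * 5 ^ d + 1) ^ (2 * 5 ^ d + 1))] with N hN
  obtain ⟨t, rfl⟩ := Nat.exists_eq_add_of_le hN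
  obtain ⟨G, hG, hcard, hcost⟩ := exists_lt_oracleCost d t
  refine hcost.le.trans
    (le_csSup ⟨2 * (2 * 5 ^ d + 1) ^ (2 * 5 ^ d + 1) + t, ?_⟩ ⟨G, hG, hcard, rfl⟩)
  rintro _ ⟨H, -, hH, rfl⟩
  exact (oracleCost_le_card _).trans ((Nat.le_add_right _ _).trans_eq hH)

theorem mainTheorem6 :
    ∃ 𝒢 : Set BipGraph, 𝒢 = k22FreePointBoxGraphs ∧
      BipGraph.IsHereditary 𝒢 ∧
      (∀ G ∈ 𝒢, G.K22Free) ∧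
      HasSignRank 𝒢 5 ∧
      Filter.Tendsto (equalityCost 𝒢) Filter.atTop Filter.atTop := by
  refine ⟨_, rfl, isHereditary_k22FreePointBoxGraphs, fun G hG => hG.2, ⟨?_, ?_⟩,
    tendsto_equalityCost_k22FreePointBoxGraphs⟩
  · obtain ⟨G, hG, h⟩ := exists_signRank_eq_five
    exact ⟨G, hG, h.symm⟩
  · rintro _ ⟨G, hG, rfl⟩
    exact signRank_le_five hG.1
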